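/- Let $K$ be a (commutative) field with $\operatorname{char}(K)\notin\{2,3,5\}$, and suppose that there is $i\in K$ with $i^2+1=0$. Put $\varphi_K((x_1,x_2),(y_1,y_2))=(x_1-y_1)^2+(x_2-y_2)^2$ for $(x_1,x_2),(y_1,y_2)\in K^2$. Let $f:K^2\to K^2$ be a map that preserves unit distance, i.e. for all $X,Y\in K^2$, $\varphi_K(X,Y)=1$ implies $\varphi_K(f(X),f(Y))=1$. Then there exist a field homomorphism $\sigma:K\to K$ and an affine map $I:K^2\to K^2$ with orthogonal linear part (that is, the matrix $A$ of the linear part of $I$ in the standard basis satisfies $A^{T}A=AA^{T}=1$) such that $f=I\circ(\sigma,\sigma)$, i.e. $f((x_1,x_2))=I((\sigma(x_1),\sigma(x_2)))$ for all $x_1,x_2\in K$. -/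

import Mathlib

/-- The quadratic distance `(x₁ - y₁)² + (x₂ - y₂)²` on the plane `K²` over a field `K`,
with values in `K`. -/
def phiK {K : Type*} [Field K] (X Y : Fin 2 → K) : K :=
  (X 0 - Y 0) ^ 2 + (X 1 - Y 1) ^ 2

/-- `f : K² → K²` preserves unit distance: points at distance `1` have images at distance `1`
(one direction only). -/
def PreservesUnitDistance {K : Type*} [Field K] (f : (Fin 2 → K) → (Fin 2 → K)) : Prop :=
  ∀ X Y : Fin 2 → K, phiK X Y = 1 → phiK (f X) (f Y) = 1

/-- An affine self-map of `K²` has orthogonal linear part: the matrix `A` of its linear part in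
the standard basis satisfies `A Aᵀ = Aᵀ A = 1`. -/
def HasOrthogonalLinearPart {K : Type*} [Field K]
    (I : (Fin 2 → K) →ᵃ[K] (Fin 2 → K)) : Prop :=
  LinearMap.toMatrix' I.linear ∈ Matrix.orthogonalGroup (Fin 2) K

/-!
In the null coordinates `u = x + i y`, `v = x - i y` the distance becomes `Δu * Δv`, and the unit
vectors are the `(t, t⁻¹)`. Two points have at most two common neighbours in the unit-distance
graph, so a rhombus is mapped to a parallelogram unless one of its diagonals is collapsed
(`add_eq_add_of_four_cycle`).

The heart of the proof is that every `F` preserving the graph is straight on lines, i.e.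
`F (x + 2 a) - F (x + a) = F (x + a) - F x` for all unit vectors `a`. There are two cases.

* If `ω ^ 2 - ω + 1 = 0` has no solution, the graph has no triangles, so points joined by a path
  with three edges have distinct images. For `r = 4 / 3` and `r = 6` both diagonals of the rhombus
  with sides `(t, t⁻¹)` and `(r t, (r t)⁻¹)` are sums of three unit vectors, so these rhombi go to
  parallelograms, and `F (x + a) - F x` has the periods `(r t, (r t)⁻¹)` and `(t / r, r / t)` when
  `a = (t, t⁻¹)`. Their sums are `25 / 12` and `37 / 6` times `a`; as `25` and `37` are coprime,
  `a` itself is a period.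
* If `ω` exists, the graph contains triangular lattices, which `F` can only fold. A fold collapses
  a vector of form value `3`, i.e. some `(s, 3 / s)`. But `4 a = (3 t, t⁻¹) + (t, 3 t⁻¹)` is a sum
  of two such vectors, each of which is collapsed or keeps form value `3`, while the image of `4 a`
  in a folded lattice is nonzero of form value `16`, `7`, `4` or `1`. Hence nothing is folded
  outside characteristic `13`, where a variant of the same computation applies.

Straightness makes `F (x + a) - F x` affine along every line. As it always has form value `1`, it
is constant, and since the unit vectors generate the plane, `F` is additive up to a translation.
An additive map preserving the unit vectors is found by inserting `t`, `2 t`, `3 t` (this needs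
`5 ≠ 0`): up to exchanging the coordinates it is `(u, v) ↦ (α u, δ v)` with `α t * δ t⁻¹ = 1`, and
Hua's identity makes `α` and `δ` multiples of a field homomorphism.
-/

section HyperbolicPlane

variable {K : Type*} [Field K]

/-! ### The hyperbolic unit-distance graph -/

/-- Adjacency in the unit-distance graph of `K × K` for the hyperbolic form `(u, v) ↦ u * v`. -/
def UnitAdj (p q : K × K) : Prop := (p.1 - q.1) * (p.2 - q.2) = 1

/-- The vectors `(t, t⁻¹)` with `t ≠ 0` are exactly those on which the form `u * v` is `1`. -/
def unitVec (t : K) : K × K := (t, t⁻¹)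

/-- `F` maps adjacent points of the hyperbolic unit-distance graph to adjacent points. -/
def PreservesUnitAdj (F : K × K → K × K) : Prop := ∀ p q, UnitAdj p q → UnitAdj (F p) (F q)

@[simp] lemma unitVec_fst (t : K) : (unitVec t).1 = t := rfl

@[simp] lemma unitVec_snd (t : K) : (unitVec t).2 = t⁻¹ := rfl

lemma UnitAdj.symm {p q : K × K} (h : UnitAdj p q) : UnitAdj q p := by
  unfold UnitAdj at *
  linear_combination h

lemma UnitAdj.ne {p q : K × K} (h : UnitAdj p q) : p ≠ q := by
  rintro rfl
  simp [UnitAdj] at h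

lemma unitAdj_add_unitVec (x : K × K) {t : K} (ht : t ≠ 0) : UnitAdj x (x + unitVec t) := by
  simp [UnitAdj, ht]

lemma unitAdj_of_sub_eq {p q : K × K} {t : K} (ht : t ≠ 0) (h : q - p = unitVec t) :
    UnitAdj p q := by
  have := unitAdj_add_unitVec p ht
  rwa [← h, add_sub_cancel] at this

/-- Two points have at most two common neighbours, and these are symmetric about the midpoint:
a 4-cycle of the unit-distance graph with distinct opposite vertices is a parallelogram. -/
lemma add_eq_add_of_four_cycle {p q r s : K × K} (hpq : UnitAdj p q) (hqr : UnitAdj q r)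
    (hrs : UnitAdj r s) (hsp : UnitAdj s p) (hpr : p ≠ r) (hqs : q ≠ s) :
    p + r = q + s := by
  obtain ⟨p1, p2⟩ := p
  obtain ⟨q1, q2⟩ := q
  obtain ⟨r1, r2⟩ := r
  obtain ⟨s1, s2⟩ := s
  simp only [UnitAdj] at *
  obtain ⟨a, rfl⟩ : ∃ a, q1 = p1 + a := ⟨q1 - p1, by ring⟩
  obtain ⟨a', rfl⟩ : ∃ a, q2 = p2 + a := ⟨q2 - p2, by ring⟩
  obtain ⟨b, rfl⟩ : ∃ a, s1 = p1 + a := ⟨s1 - p1, by ring⟩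
  obtain ⟨b', rfl⟩ : ∃ a, s2 = p2 + a := ⟨s2 - p2, by ring⟩
  obtain ⟨c, rfl⟩ : ∃ a, r1 = p1 + a := ⟨r1 - p1, by ring⟩
  obtain ⟨c', rfl⟩ : ∃ a, r2 = p2 + a := ⟨r2 - p2, by ring⟩
  have ha : a * a' = 1 := by linear_combination hpq
  have hb : b * b' = 1 := by linear_combination hsp
  have hac : c * c' = a * c' + a' * c := by linear_combination hqr - ha
  have hbc : c * c' = b * c' + b' * c := by linear_combination hrs - hb
  have hab : a ≠ b := by
    rintro rfl
    apply hqs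
    have ha0 : a ≠ 0 := left_ne_zero_of_mul_eq_one ha
    have : a' = b' := mul_left_cancel₀ ha0 (ha.trans hb.symm)
    rw [this]
  have h1 : c = a * b * c' := by
    have : (a - b) * (c - a * b * c') = 0 := by
      linear_combination (a * b) * (hac - hbc) + b * c * ha - a * c * hb
    rcases mul_eq_zero.1 this with h | h
    · exact absurd (sub_eq_zero.1 h) hab
    · exact sub_eq_zero.1 h
  have hc' : c' ≠ 0 := by
    intro h
    apply hpr
    rw [h1, h]
    simp
  have h2 : c = a + b := by
    apply mul_right_cancel₀ hc'
    linear_combination hac + a' * h1 + b * c' * ha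
  have h3 : c' = a' + b' := by
    linear_combination (a' * b') * (h2 - h1) - c' * b * b' * ha - c' * hb + b' * ha + a' * hb
  ext
  · simp only [Prod.mk_add_mk]; linear_combination h2
  · simp only [Prod.mk_add_mk]; linear_combination h3

/-- Three mutually adjacent points determine a primitive sixth root of unity. -/
lemma sq_sub_mul_add_sq_of_triangle {p q r : K × K} (hpq : UnitAdj p q) (hpr : UnitAdj p r)
    (hqr : UnitAdj q r) :
    (q.1 - p.1) ^ 2 - (q.1 - p.1) * (r.1 - p.1) + (r.1 - p.1) ^ 2 = 0 := by
  simp only [UnitAdj] at *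
  linear_combination (-(r.1 - p.1) ^ 2 + (q.1 - p.1) * (r.1 - p.1)) * hpq
    + (-(q.1 - p.1) ^ 2 + (q.1 - p.1) * (r.1 - p.1)) * hpr
    - (q.1 - p.1) * (r.1 - p.1) * hqr

/-! ### Periods of difference maps -/

/-- The periods of the difference map `x ↦ F (x + a) - F x`, as a subgroup of the plane. -/
def stepPeriods (F : K × K → K × K) (a : K × K) : AddSubgroup (K × K) where
  carrier := {v | ∀ x, F (x + v + a) - F (x + v) = F (x + a) - F x}
  zero_mem' := by intro x; simp
  add_mem' := by
    intro v w hv hw x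
    rw [← add_assoc, hw, hv]
  neg_mem' := by
    intro v hv x
    have := hv (x + -v)
    rwa [neg_add_cancel_right, eq_comm] at this

lemma mem_stepPeriods_comm {F : K × K → K × K} {a b : K × K} (h : a ∈ stepPeriods F b) :
    b ∈ stepPeriods F a := by
  intro x
  have := h x
  rw [add_right_comm] at this
  linear_combination (exp := 1) this

/-- If `F` identifies neither of the two diagonals of any rhombus with side vectors
`(s, s⁻¹)` and `(t, t⁻¹)`, then it maps all these rhombi to parallelograms. -/
lemma unitVec_mem_stepPeriods {F : K × K → K × K} (hF : PreservesUnitAdj F) {s t : K}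
    (hs : s ≠ 0) (ht : t ≠ 0) (hadd : ∀ x, F (x + (unitVec s + unitVec t)) ≠ F x)
    (hsub : ∀ x, F (x + (unitVec s - unitVec t)) ≠ F x) :
    unitVec s ∈ stepPeriods F (unitVec t) := by
  intro x
  have h := add_eq_add_of_four_cycle (hF _ _ (unitAdj_add_unitVec x hs))
    (hF _ _ (unitAdj_add_unitVec (x + unitVec s) ht))
    (by rw [add_right_comm]; exact (hF _ _ (unitAdj_add_unitVec (x + unitVec t) hs)).symm)
    (hF _ _ (unitAdj_add_unitVec x ht)).symm
    (by rw [add_assoc]; exact (hadd x).symm)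
    (by
      have := hsub (x + unitVec t)
      rwa [add_add_sub_cancel] at this)
  linear_combination (exp := 1) h

/-! ### Fields without a primitive sixth root of unity -/

/-- Without triangles in the graph, the ends of a path with three edges are never identified. -/
lemma map_add_three_unitVec_ne {F : K × K → K × K} (hF : PreservesUnitAdj F)
    (hω : ∀ t : K, t ^ 2 - t + 1 ≠ 0) {a b c : K} (ha : a ≠ 0) (hb : b ≠ 0) (hc : c ≠ 0)
    (x : K × K) : F (x + (unitVec a + unitVec b + unitVec c)) ≠ F x := by
  intro h
  have h1 := hF _ _ (unitAdj_add_unitVec x ha)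
  have h2 := hF _ _ (unitAdj_add_unitVec (x + unitVec a) hb)
  have h3 := hF _ _ (unitAdj_add_unitVec (x + unitVec a + unitVec b) hc)
  rw [show x + unitVec a + unitVec b + unitVec c = x + (unitVec a + unitVec b + unitVec c) by
    abel, h] at h3
  have h4 := sq_sub_mul_add_sq_of_triangle h1 h3.symm h2
  have h5 : (F (x + unitVec a)).1 - (F x).1 ≠ 0 := by
    intro h0
    have h1' := h1.symm
    simp [UnitAdj, h0] at h1'
  apply hω (((F (x + unitVec a + unitVec b)).1 - (F x).1) / ((F (x + unitVec a)).1 - (F x).1))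
  field_simp
  linear_combination h4

/-- A difference map along `(t, t⁻¹)` is invariant under translation by `(t, t⁻¹)` itself: the
diagonals of the rhombi over `t` and `4 * t / 3`, and over `t` and `6 * t`, are sums of three unit
vectors, which provides enough other periods to generate `(t, t⁻¹)`. -/
lemma unitVec_mem_stepPeriods_self_of_no_triangle (h2 : (2 : K) ≠ 0) (h3 : (3 : K) ≠ 0)
    (h5 : (5 : K) ≠ 0) {F : K × K → K × K} (hF : PreservesUnitAdj F)
    (hω : ∀ t : K, t ^ 2 - t + 1 ≠ 0) {t : K} (ht : t ≠ 0) :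
    unitVec t ∈ stepPeriods F (unitVec t) := by
  have h7 : (7 : K) ≠ 0 := fun h => hω 3 (by linear_combination h)
  have h4 : (4 : K) ≠ 0 := by rw [show (4 : K) = 2 * 2 by norm_num]; exact mul_ne_zero h2 h2
  have h6 : (6 : K) ≠ 0 := by rw [show (6 : K) = 2 * 3 by norm_num]; exact mul_ne_zero h2 h3
  have h10 : (10 : K) ≠ 0 := by rw [show (10 : K) = 2 * 5 by norm_num]; exact mul_ne_zero h2 h5
  have h15 : (15 : K) ≠ 0 := by rw [show (15 : K) = 3 * 5 by norm_num]; exact mul_ne_zero h3 h5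
  have h9 : (9 : K) ≠ 0 := by rw [show (9 : K) = 3 * 3 by norm_num]; exact mul_ne_zero h3 h3
  have h18 : (18 : K) ≠ 0 := by rw [show (18 : K) = 6 * 3 by norm_num]; exact mul_ne_zero h6 h3
  have h28 : (28 : K) ≠ 0 := by rw [show (28 : K) = 4 * 7 by norm_num]; exact mul_ne_zero h4 h7
  have h30 : (30 : K) ≠ 0 := by rw [show (30 : K) = 10 * 3 by norm_num]; exact mul_ne_zero h10 h3
  -- Sums of three unit vectors, scaled by `t`, in a form that suits concrete `a`, `b`, `c`.
  have sum_ne (p q a b c : K) (ha : a ≠ 0) (hb : b ≠ 0) (hc : c ≠ 0) (hp : p = a + b + c)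
      (hq : q = a⁻¹ + b⁻¹ + c⁻¹) {t : K} (ht : t ≠ 0) (x : K × K) :
      F (x + (p * t, q * t⁻¹)) ≠ F x := by
    have e : (p * t, q * t⁻¹) = unitVec (a * t) + unitVec (b * t) + unitVec (c * t) := by
      ext
      · simp [hp, add_mul]
      · simp [hq, add_mul, mul_comm]
    rw [e]
    exact map_add_three_unitVec_ne hF hω (mul_ne_zero ha ht) (mul_ne_zero hb ht)
      (mul_ne_zero hc ht) x
  have add_eq (s t : K) : unitVec (s * t) + unitVec t = ((s + 1) * t, (s⁻¹ + 1) * t⁻¹) := by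
    ext <;> simp <;> ring
  have sub_eq (s t : K) : unitVec (s * t) - unitVec t = ((s - 1) * t, (s⁻¹ - 1) * t⁻¹) := by
    ext <;> simp <;> ring
  have k1 {t : K} (ht : t ≠ 0) : unitVec (4 / 3 * t) ∈ stepPeriods F (unitVec t) := by
    refine unitVec_mem_stepPeriods hF (mul_ne_zero (div_ne_zero h4 h3) ht) ht ?_ ?_
    · rw [add_eq]
      refine sum_ne _ _ (5 / 2) (-(4 / 9)) (5 / 18) ?_ ?_ ?_ ?_ ?_ ht
      · simp [*]
      · simp [*]
      · simp [*]
      · field_simp; norm_num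
      · field_simp; norm_num
    · rw [sub_eq]
      refine sum_ne _ _ (4 / 15) (1 / 6) (-(1 / 10)) ?_ ?_ ?_ ?_ ?_ ht
      · simp [*]
      · simp [*]
      · simp [*]
      · field_simp; norm_num
      · field_simp; norm_num
  have k2 {t : K} (ht : t ≠ 0) : unitVec (6 * t) ∈ stepPeriods F (unitVec t) := by
    refine unitVec_mem_stepPeriods hF (mul_ne_zero h6 ht) ht ?_ ?_
    · rw [add_eq]
      refine sum_ne _ _ 10 (-(15 / 4)) (3 / 4) ?_ ?_ ?_ ?_ ?_ ht
      · simp [*]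
      · simp [*]
      · simp [*]
      · field_simp; norm_num
      · field_simp; norm_num
    · rw [sub_eq]
      refine sum_ne _ _ (30 / 7) (5 / 4) (-(15 / 28)) ?_ ?_ ?_ ?_ ?_ ht
      · simp [*]
      · simp [*]
      · simp [*]
      · field_simp; norm_num
      · field_simp; norm_num
  have k1' : unitVec (3 / 4 * t) ∈ stepPeriods F (unitVec t) := by
    have := mem_stepPeriods_comm (k1 (t := 3 / 4 * t) (mul_ne_zero (div_ne_zero h3 h4) ht))
    rwa [show 4 / 3 * (3 / 4 * t) = t by field_simp] at this
  have k2' : unitVec (t / 6) ∈ stepPeriods F (unitVec t) := by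
    have := mem_stepPeriods_comm (k2 (t := t / 6) (div_ne_zero ht h6))
    rwa [mul_div_cancel₀ _ h6] at this
  -- `36 * (4/3 + 3/4) - 12 * (6 + 1/6) = 75 - 74`.
  have e : unitVec t = 36 • (unitVec (4 / 3 * t) + unitVec (3 / 4 * t))
      - 12 • (unitVec (6 * t) + unitVec (t / 6)) := by
    ext
    · simp; field_simp; ring
    · simp; field_simp; ring
  have hmem := sub_mem (AddSubgroup.nsmul_mem _ (add_mem (k1 ht) k1') 36)
    (AddSubgroup.nsmul_mem _ (add_mem (k2 ht) k2') 12)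
  rwa [← e] at hmem

/-! ### Fields with a primitive sixth root of unity -/

/-- For four nonzero numbers with equal cubes, the sum of the numbers times the sum of their
inverses is `7`, `4` or `1`, unless all four agree. The second part shows that the two sums do
not both vanish when `2` and `5` are invertible. -/
lemma sum_mul_sum_inv_of_cube_eq {ω : K} (hω : ω ^ 2 - ω + 1 = 0) {a b c d : K} (ha : a ≠ 0)
    (hb : b ^ 3 = a ^ 3) (hc : c ^ 3 = a ^ 3) (hd : d ^ 3 = a ^ 3) :
    (b = a ∧ c = a ∧ d = a ∨
      (a + b + c + d) * (a⁻¹ + b⁻¹ + c⁻¹ + d⁻¹) ∈ ({7, 4, 1} : Set K)) ∧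
    (a + b + c + d) * a⁻¹ + (a⁻¹ + b⁻¹ + c⁻¹ + d⁻¹) * a ∈ ({8, 5, 2, -1} : Set K) := by
  -- The cube roots of unity are `p + q * ω` with inverse `p + q - q * ω` for these `p`, `q`.
  have root {b : K} (hb : b ^ 3 = a ^ 3) : ∃ p q : K,
      (p = 1 ∧ q = 0 ∨ p = 0 ∧ q = -1 ∨ p = -1 ∧ q = 1) ∧
        b = (p + q * ω) * a ∧ b⁻¹ = (p + q - q * ω) * a⁻¹ := by
    have h : (b - a) * ((b - -ω * a) * (b - (ω - 1) * a)) = 0 := by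
      linear_combination hb - (b - a) * a ^ 2 * hω
    rcases mul_eq_zero.1 h with h | h
    · refine ⟨1, 0, by simp, ?_, ?_⟩ <;> simp [sub_eq_zero.1 h]
    rcases mul_eq_zero.1 h with h | h
    · refine ⟨0, -1, by simp, by linear_combination h, ?_⟩
      rw [sub_eq_zero.1 h, mul_inv]
      congr 1
      exact inv_eq_of_mul_eq_one_right (by linear_combination -hω)
    · refine ⟨-1, 1, by simp, by linear_combination h, ?_⟩
      rw [sub_eq_zero.1 h, mul_inv]
      congr 1
      exact inv_eq_of_mul_eq_one_right (by linear_combination -hω)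
  have haa : a * a⁻¹ = 1 := mul_inv_cancel₀ ha
  obtain ⟨p₁, q₁, h₁, hb₁, hb₂⟩ := root hb
  obtain ⟨p₂, q₂, h₂, hc₁, hc₂⟩ := root hc
  obtain ⟨p₃, q₃, h₃, hd₁, hd₂⟩ := root hd
  have hN : (a + b + c + d) * (a⁻¹ + b⁻¹ + c⁻¹ + d⁻¹) = (1 + p₁ + p₂ + p₃) ^ 2
      + (1 + p₁ + p₂ + p₃) * (q₁ + q₂ + q₃) + (q₁ + q₂ + q₃) ^ 2 := by
    rw [hb₂, hc₂, hd₂, hb₁, hc₁, hd₁]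
    linear_combination ((1 + p₁ + p₂ + p₃ + (q₁ + q₂ + q₃) * ω) *
      (1 + p₁ + p₂ + p₃ + (q₁ + q₂ + q₃) - (q₁ + q₂ + q₃) * ω)) * haa - (q₁ + q₂ + q₃) ^ 2 * hω
  have hT : (a + b + c + d) * a⁻¹ + (a⁻¹ + b⁻¹ + c⁻¹ + d⁻¹) * a =
      2 * (1 + p₁ + p₂ + p₃) + (q₁ + q₂ + q₃) := by
    rw [hb₂, hc₂, hd₂, hb₁, hc₁, hd₁]
    linear_combination (2 * (1 + p₁ + p₂ + p₃) + (q₁ + q₂ + q₃)) * haa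
  rw [hN, hT]
  constructor
  · by_cases hq : q₁ = 0 ∧ q₂ = 0 ∧ q₃ = 0
    · left
      obtain ⟨rfl, rfl, rfl⟩ := hq
      have hp₁ : p₁ = 1 := by simpa using h₁
      have hp₂ : p₂ = 1 := by simpa using h₂
      have hp₃ : p₃ = 1 := by simpa using h₃
      simp [hb₁, hc₁, hd₁, hp₁, hp₂, hp₃]
    · right
      rcases h₁ with ⟨rfl, rfl⟩ | ⟨rfl, rfl⟩ | ⟨rfl, rfl⟩ <;>
      rcases h₂ with ⟨rfl, rfl⟩ | ⟨rfl, rfl⟩ | ⟨rfl, rfl⟩ <;>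
      rcases h₃ with ⟨rfl, rfl⟩ | ⟨rfl, rfl⟩ | ⟨rfl, rfl⟩ <;>
      first
      | exact absurd ⟨rfl, rfl, rfl⟩ hq
      | norm_num
  · rcases h₁ with ⟨rfl, rfl⟩ | ⟨rfl, rfl⟩ | ⟨rfl, rfl⟩ <;>
    rcases h₂ with ⟨rfl, rfl⟩ | ⟨rfl, rfl⟩ | ⟨rfl, rfl⟩ <;>
    rcases h₃ with ⟨rfl, rfl⟩ | ⟨rfl, rfl⟩ | ⟨rfl, rfl⟩ <;>
    norm_num

section Triangles

variable {F : K × K → K × K} {ω : K}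

lemma ne_zero_of_sq_sub_add_one (hω : ω ^ 2 - ω + 1 = 0) : ω ≠ 0 := by
  rintro rfl
  simp at hω

lemma inv_eq_one_sub (hω : ω ^ 2 - ω + 1 = 0) : ω⁻¹ = 1 - ω :=
  inv_eq_of_mul_eq_one_right (by linear_combination -hω)

/-- `0`, `(t, t⁻¹)`, `(ω * t, (ω * t)⁻¹)` are the vertices of an equilateral triangle. -/
lemma unitVec_sub_unitVec_mul (hω : ω ^ 2 - ω + 1 = 0) (t : K) :
    unitVec t - unitVec (ω * t) = unitVec ((1 - ω) * t) := by
  have h : (1 - ω)⁻¹ = ω := inv_eq_of_mul_eq_one_right (by linear_combination -hω)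
  ext
  · simp; ring
  · simp only [Prod.snd_sub, unitVec_snd, mul_inv, h, inv_eq_one_sub hω]; ring

lemma one_add_ne_zero_of_sq_sub_add_one (h3 : (3 : K) ≠ 0) (hω : ω ^ 2 - ω + 1 = 0) :
    1 + ω ≠ 0 := fun h => h3 (by linear_combination (2 - ω) * h + hω)

/-- The vectors `(s, 3 / s)` are the long diagonals of rhombi made of two equilateral
triangles. -/
lemma exists_norm_three_eq_add (h3 : (3 : K) ≠ 0) (hω : ω ^ 2 - ω + 1 = 0) {s : K} (hs : s ≠ 0) :
    ∃ t ≠ 0, (s, 3 / s) = unitVec t + unitVec (ω * t) := by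
  have h1 := one_add_ne_zero_of_sq_sub_add_one h3 hω
  refine ⟨s / (1 + ω), div_ne_zero hs h1, ?_⟩
  ext
  · simp only [Prod.fst_add, unitVec_fst]
    field_simp
  · simp only [Prod.snd_add, unitVec_snd, mul_inv, inv_eq_one_sub hω, inv_div]
    field_simp
    linear_combination hω

/-- The image of a vector `(s, 3 / s)` either vanishes or has form value `3` again. -/
lemma map_add_norm_three (h3 : (3 : K) ≠ 0) (hF : PreservesUnitAdj F) (hω : ω ^ 2 - ω + 1 = 0)
    {s : K} (hs : s ≠ 0) (x : K × K) : F (x + (s, 3 / s)) = F x ∨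
      ((F (x + (s, 3 / s))).1 - (F x).1) * ((F (x + (s, 3 / s))).2 - (F x).2) = 3 := by
  obtain ⟨t, ht, e⟩ := exists_norm_three_eq_add h3 hω hs
  have hω0 := ne_zero_of_sq_sub_add_one hω
  have hω1 : 1 - ω ≠ 0 := by rw [← inv_eq_one_sub hω]; exact inv_ne_zero hω0
  rw [e, or_iff_not_imp_left, ← add_assoc]
  intro hne
  have h1 := hF _ _ (unitAdj_add_unitVec x ht)
  have h2 := hF _ _ (unitAdj_add_unitVec (x + unitVec t) (mul_ne_zero hω0 ht))
  have h3 : UnitAdj (F (x + unitVec (ω * t))) (F (x + unitVec t + unitVec (ω * t))) := by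
    rw [add_right_comm]; exact hF _ _ (unitAdj_add_unitVec _ ht)
  have h4 := hF _ _ (unitAdj_add_unitVec x (mul_ne_zero hω0 ht))
  have h5 : UnitAdj (F (x + unitVec (ω * t))) (F (x + unitVec t)) :=
    hF _ _ (unitAdj_of_sub_eq (mul_ne_zero hω1 ht)
      (by rw [← unitVec_sub_unitVec_mul hω, add_sub_add_left_eq_sub]))
  have h := add_eq_add_of_four_cycle h1 h2 h3.symm h4.symm (Ne.symm hne) h5.ne.symm
  have e1 := congrArg Prod.fst h
  have e2 := congrArg Prod.snd h
  simp only [Prod.fst_add, Prod.snd_add] at e1 e2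
  rw [← eq_sub_iff_add_eq'] at e1 e2
  rw [e1, e2]
  simp only [UnitAdj] at h1 h4 h5
  linear_combination 2 * h1 + 2 * h4 - h5

/-- If no vector `(s, 3 / s)` is collapsed, `F` unfolds the strip of equilateral triangles over
a segment of length two, so that segment is mapped to a straight one. -/
lemma unitVec_mem_stepPeriods_self_of_norm_three_ne (h3 : (3 : K) ≠ 0) (hF : PreservesUnitAdj F)
    (hω : ω ^ 2 - ω + 1 = 0) (hne : ∀ s ≠ 0, ∀ x, F (x + (s, 3 / s)) ≠ F x) {t : K}
    (ht : t ≠ 0) : unitVec t ∈ stepPeriods F (unitVec t) := by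
  have hω0 := ne_zero_of_sq_sub_add_one hω
  have h1 := one_add_ne_zero_of_sq_sub_add_one h3 hω
  have hω1 : 1 - ω ≠ 0 := by rw [← inv_eq_one_sub hω]; exact inv_ne_zero hω0
  have hne' {t : K} (ht : t ≠ 0) (x) : F (x + unitVec t + unitVec (ω * t)) ≠ F x := by
    convert hne ((1 + ω) * t) (mul_ne_zero h1 ht) x using 2
    rw [add_assoc]
    congr 1
    ext
    · simp; ring
    · simp only [Prod.snd_add, unitVec_snd, mul_inv, inv_eq_one_sub hω]
      field_simp
      linear_combination -hω
  have hd : unitVec ((1 - ω) * t) = unitVec t - unitVec (ω * t) :=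
    (unitVec_sub_unitVec_mul hω t).symm
  intro x
  have a1 := hF _ _ (unitAdj_add_unitVec x ht)
  have a2 := hF _ _ (unitAdj_add_unitVec (x + unitVec t) (mul_ne_zero hω0 ht))
  have a3 : UnitAdj (F (x + unitVec (ω * t))) (F (x + unitVec t + unitVec (ω * t))) := by
    rw [add_right_comm]; exact hF _ _ (unitAdj_add_unitVec _ ht)
  have a4 := hF _ _ (unitAdj_add_unitVec x (mul_ne_zero hω0 ht))
  have a5 : UnitAdj (F (x + unitVec (ω * t))) (F (x + unitVec t)) :=
    hF _ _ (unitAdj_of_sub_eq (mul_ne_zero hω1 ht) (by rw [hd]; abel))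
  have a6 : UnitAdj (F (x + unitVec t + unitVec (ω * t))) (F (x + unitVec t + unitVec t)) :=
    hF _ _ (unitAdj_of_sub_eq (mul_ne_zero hω1 ht) (by rw [hd]; abel))
  have a7 := hF _ _ (unitAdj_add_unitVec (x + unitVec t) ht)
  have p1 := add_eq_add_of_four_cycle a1 a2 a3.symm a4.symm (hne' ht x).symm a5.ne.symm
  have hlong : F (x + unitVec t + unitVec t) ≠ F (x + unitVec (ω * t)) := by
    have := hne' (mul_ne_zero hω1 ht) (x + unitVec (ω * t))
    rwa [show ω * ((1 - ω) * t) = t by linear_combination -t * hω, hd, add_assoc x,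
      add_sub_cancel] at this
  have p2 := add_eq_add_of_four_cycle a5 a7 a6.symm a3.symm hlong.symm a2.ne
  linear_combination (exp := 1) p2 + p1

/-- Consecutive steps along a line are mapped to steps differing by a cube root of unity. -/
lemma step_pow_three_eq (hF : PreservesUnitAdj F) (hω : ω ^ 2 - ω + 1 = 0) {t : K} (ht : t ≠ 0)
    (x : K × K) : ((F (x + unitVec t + unitVec t)).1 - (F (x + unitVec t)).1) ^ 3 =
      ((F (x + unitVec t)).1 - (F x).1) ^ 3 := by
  have hω0 := ne_zero_of_sq_sub_add_one hω
  have hω1 : 1 - ω ≠ 0 := by rw [← inv_eq_one_sub hω]; exact inv_ne_zero hω0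
  have hd : unitVec ((1 - ω) * t) = unitVec t - unitVec (ω * t) :=
    (unitVec_sub_unitVec_mul hω t).symm
  have a1 := hF _ _ (unitAdj_add_unitVec x ht)
  have a2 := hF _ _ (unitAdj_add_unitVec (x + unitVec t) (mul_ne_zero hω0 ht))
  have a3 : UnitAdj (F (x + unitVec (ω * t))) (F (x + unitVec t + unitVec (ω * t))) := by
    rw [add_right_comm]; exact hF _ _ (unitAdj_add_unitVec _ ht)
  have a4 := hF _ _ (unitAdj_add_unitVec x (mul_ne_zero hω0 ht))
  have a5 : UnitAdj (F (x + unitVec (ω * t))) (F (x + unitVec t)) :=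
    hF _ _ (unitAdj_of_sub_eq (mul_ne_zero hω1 ht) (by rw [hd]; abel))
  have a6 : UnitAdj (F (x + unitVec t + unitVec (ω * t))) (F (x + unitVec t + unitVec t)) :=
    hF _ _ (unitAdj_of_sub_eq (mul_ne_zero hω1 ht) (by rw [hd]; abel))
  have a7 := hF _ _ (unitAdj_add_unitVec (x + unitVec t) ht)
  have c1 := sq_sub_mul_add_sq_of_triangle a1.symm a5.symm a4
  have c2 := sq_sub_mul_add_sq_of_triangle a5.symm a2 a3
  have c3 := sq_sub_mul_add_sq_of_triangle a2 a7 a6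
  set u := (F (x + unitVec t)).1
  linear_combination (((F (x + unitVec t + unitVec (ω * t))).1 - u) +
      ((F (x + unitVec t + unitVec t)).1 - u)) * c3
    - (((F (x + unitVec (ω * t))).1 - u) + ((F (x + unitVec t + unitVec (ω * t))).1 - u)) * c2
    + (((F x).1 - u) + ((F (x + unitVec (ω * t))).1 - u)) * c1

/-- The image of a segment of length four: its form value is `16`, with a straight beginning, or
`7`, `4` or `1`, and its ends remain distinct. -/
lemma map_add_four_unitVec (h2 : (2 : K) ≠ 0) (h5 : (5 : K) ≠ 0) (hF : PreservesUnitAdj F)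
    (hω : ω ^ 2 - ω + 1 = 0) {t : K} (ht : t ≠ 0) (x y : K × K) (hy : y = x + (4 * t, 4 * t⁻¹)) :
    (F (x + unitVec t + unitVec t) - F (x + unitVec t) = F (x + unitVec t) - F x ∧
        ((F y).1 - (F x).1) * ((F y).2 - (F x).2) = 16 ∨
      ((F y).1 - (F x).1) * ((F y).2 - (F x).2) ∈ ({7, 4, 1} : Set K)) ∧ F y ≠ F x := by
  have hy' : y = x + unitVec t + unitVec t + unitVec t + unitVec t := by
    rw [hy]
    ext
    · simp; ring
    · simp; ring
  rw [hy']
  set x₁ := x + unitVec t with hx₁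
  set x₂ := x₁ + unitVec t with hx₂
  set x₃ := x₂ + unitVec t with hx₃
  set x₄ := x₃ + unitVec t with hx₄
  have snd_eq {p q : K × K} (h : UnitAdj p q) : q.2 - p.2 = (q.1 - p.1)⁻¹ :=
    (inv_eq_of_mul_eq_one_right h.symm).symm
  have a1 : UnitAdj (F x) (F x₁) := hF _ _ (unitAdj_add_unitVec _ ht)
  have a2 : UnitAdj (F x₁) (F x₂) := hF _ _ (unitAdj_add_unitVec _ ht)
  have a3 : UnitAdj (F x₂) (F x₃) := hF _ _ (unitAdj_add_unitVec _ ht)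
  have a4 : UnitAdj (F x₃) (F x₄) := hF _ _ (unitAdj_add_unitVec _ ht)
  have c2 : ((F x₂).1 - (F x₁).1) ^ 3 = ((F x₁).1 - (F x).1) ^ 3 := step_pow_three_eq hF hω ht x
  have c3 : ((F x₃).1 - (F x₂).1) ^ 3 = ((F x₂).1 - (F x₁).1) ^ 3 :=
    step_pow_three_eq hF hω ht x₁
  have c4 : ((F x₄).1 - (F x₃).1) ^ 3 = ((F x₃).1 - (F x₂).1) ^ 3 :=
    step_pow_three_eq hF hω ht x₂
  have ha : (F x₁).1 - (F x).1 ≠ 0 := left_ne_zero_of_mul_eq_one a1.symm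
  have key := sum_mul_sum_inv_of_cube_eq hω ha c2 (c3.trans c2) (c4.trans (c3.trans c2))
  rw [← snd_eq a1, ← snd_eq a2, ← snd_eq a3, ← snd_eq a4] at key
  have e1 : (F x₁).1 - (F x).1 + ((F x₂).1 - (F x₁).1) + ((F x₃).1 - (F x₂).1) +
    ((F x₄).1 - (F x₃).1) = (F x₄).1 - (F x).1 := by ring
  have e2 : (F x₁).2 - (F x).2 + ((F x₂).2 - (F x₁).2) + ((F x₃).2 - (F x₂).2) +
    ((F x₄).2 - (F x₃).2) = (F x₄).2 - (F x).2 := by ring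
  rw [e1, e2] at key
  obtain ⟨k1, k2⟩ := key
  constructor
  · refine k1.imp_left ?_
    rintro ⟨b1, b2, b3⟩
    have s2 := snd_eq a2
    have s3 := snd_eq a3
    have s4 := snd_eq a4
    rw [b1, ← snd_eq a1] at s2
    rw [b2, ← snd_eq a1] at s3
    rw [b3, ← snd_eq a1] at s4
    refine ⟨Prod.ext b1 s2, ?_⟩
    rw [← e1, ← e2, b1, b2, b3, s2, s3, s4]
    have a1' : ((F x).1 - (F x₁).1) * ((F x).2 - (F x₁).2) = 1 := a1
    linear_combination 16 * a1'
  · intro h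
    simp only [h, sub_self, zero_mul, add_zero, Set.mem_insert_iff, Set.mem_singleton_iff] at k2
    have h8 : (8 : K) ≠ 0 := by
      rw [show (8 : K) = 2 * 2 * 2 by norm_num]
      exact mul_ne_zero (mul_ne_zero h2 h2) h2
    rcases k2 with k | k | k | k
    · exact h8 k.symm
    · exact h5 k.symm
    · exact h2 k.symm
    · exact one_ne_zero (α := K) (by linear_combination k)

/-- A difference map along `(t, t⁻¹)` is invariant under translation by `(t, t⁻¹)` itself: a
collapsed vector of form value `3` would give the image of `4 * (t, t⁻¹)` form value `0` or `3`,
against `map_add_four_unitVec`. -/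
lemma unitVec_mem_stepPeriods_self_of_triangle (h2 : (2 : K) ≠ 0) (h3 : (3 : K) ≠ 0)
    (h5 : (5 : K) ≠ 0) (hF : PreservesUnitAdj F) (hω : ω ^ 2 - ω + 1 = 0) {t : K} (ht : t ≠ 0) :
    unitVec t ∈ stepPeriods F (unitVec t) := by
  have h4 : (4 : K) ≠ 0 := by rw [show (4 : K) = 2 * 2 by norm_num]; exact mul_ne_zero h2 h2
  by_cases h13 : (13 : K) = 0
  · -- In characteristic `13` the vector `(4 * t, 4 / t)` itself has form value `3`.
    intro x
    obtain ⟨h, hne⟩ := map_add_four_unitVec h2 h5 hF hω ht x _ rfl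
    have e : (4 * t, 4 * t⁻¹) = (4 * t, 3 / (4 * t)) := by
      ext
      · rfl
      · simp only
        field_simp
        linear_combination h13
    rcases h with ⟨h, -⟩ | h
    · exact h
    · rw [e] at h hne
      rw [(map_add_norm_three h3 hF hω (mul_ne_zero h4 ht) x).resolve_left hne] at h
      simp only [Set.mem_insert_iff, Set.mem_singleton_iff] at h
      rcases h with h | h | h
      · exact absurd (by linear_combination -h) h4
      · exact absurd (by linear_combination -h) (one_ne_zero (α := K))
      · exact absurd (by linear_combination h) h2
  · refine unitVec_mem_stepPeriods_self_of_norm_three_ne h3 hF hω (fun s hs x hx => ?_) ht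
    -- `4 * (t, t⁻¹) = (3 * t, t⁻¹) + (t, 3 * t⁻¹)` is a sum of two vectors of form value `3`.
    have ht' : s / 3 ≠ 0 := div_ne_zero hs h3
    obtain ⟨h, hne⟩ := map_add_four_unitVec h2 h5 hF hω ht' x
      (x + (s, 3 / s) + (s / 3, 3 / (s / 3))) (by
        rw [add_assoc]
        congr 1
        ext
        · simp only [Prod.mk_add_mk]; field_simp; norm_num
        · simp only [Prod.mk_add_mk]; field_simp; norm_num)
    rcases map_add_norm_three h3 hF hω ht' (x + (s, 3 / s)) with h' | h'
    · exact hne (h'.trans hx)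
    · rw [hx] at h'
      rw [h'] at h
      simp only [Set.mem_insert_iff, Set.mem_singleton_iff] at h
      rcases h with ⟨-, h⟩ | h | h | h
      · exact h13 (by linear_combination -h)
      · exact h4 (by linear_combination -h)
      · exact one_ne_zero (α := K) (by linear_combination -h)
      · exact h2 (by linear_combination h)

end Triangles

/-! ### Additivity -/

/-- If all lines are mapped straight, the difference along one unit vector varies affinely along
another one while keeping form value `1`, which forces it to be constant. -/
lemma unitVec_mem_stepPeriods_of_self (h2 : (2 : K) ≠ 0) {F : K × K → K × K}
    (hF : PreservesUnitAdj F) (hs : ∀ t ≠ 0, unitVec t ∈ stepPeriods F (unitVec t)) {s t : K}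
    (hs0 : s ≠ 0) (ht : t ≠ 0) : unitVec s ∈ stepPeriods F (unitVec t) := by
  intro x
  have p := hs s hs0 x
  have q := hs s hs0 (x + unitVec t)
  have a0 := (hF _ _ (unitAdj_add_unitVec x ht)).symm
  have a1 := (hF _ _ (unitAdj_add_unitVec (x + unitVec s) ht)).symm
  have a2 := (hF _ _ (unitAdj_add_unitVec (x + unitVec s + unitVec s) ht)).symm
  rw [add_right_comm x, add_right_comm _ (unitVec t)] at q
  have q1 := congrArg Prod.fst q
  have q2 := congrArg Prod.snd q
  have p1 := congrArg Prod.fst p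
  have p2 := congrArg Prod.snd p
  simp only [UnitAdj, Prod.fst_sub, Prod.snd_sub] at a0 a1 a2 p1 p2 q1 q2
  set d := (F (x + unitVec t)).1 - (F x).1 with hd
  set d' := (F (x + unitVec t)).2 - (F x).2 with hd'
  obtain ⟨e, he⟩ : ∃ e, (F (x + unitVec s + unitVec t)).1 - (F (x + unitVec s)).1 = d + e :=
    ⟨_, (add_sub_cancel _ _).symm⟩
  obtain ⟨e', he'⟩ : ∃ e, (F (x + unitVec s + unitVec t)).2 - (F (x + unitVec s)).2 = d' + e :=
    ⟨_, (add_sub_cancel _ _).symm⟩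
  have he2 : (F (x + unitVec s + unitVec s + unitVec t)).1 - (F (x + unitVec s + unitVec s)).1
      = d + 2 * e := by linear_combination q1 - p1 + 2 * he - hd
  have he2' : (F (x + unitVec s + unitVec s + unitVec t)).2 - (F (x + unitVec s + unitVec s)).2
      = d' + 2 * e' := by linear_combination q2 - p2 + 2 * he' - hd'
  rw [he, he'] at a1
  rw [he2, he2'] at a2
  have hee : e * e' = 0 := by
    refine mul_left_cancel₀ h2 ?_
    linear_combination a2 - 2 * a1 + a0
  have hl : d * e' + d' * e = 0 := by linear_combination a1 - a0 - hee
  have e0 : e = 0 := by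
    apply pow_eq_zero_iff two_ne_zero |>.1
    linear_combination d * e * hl - d ^ 2 * hee - e ^ 2 * a0
  have e0' : e' = 0 := by
    apply pow_eq_zero_iff two_ne_zero |>.1
    linear_combination d' * e' * hl - d' ^ 2 * hee - e' ^ 2 * a0
  refine Prod.ext ?_ ?_
  · simpa [e0] using he
  · simpa [e0'] using he'

/-- The unit vectors generate the plane: `2 * (t, t⁻¹) - (t / 2, 2 * t⁻¹)` is `(3 * t / 2, 0)`. -/
lemma addSubgroup_eq_top_of_unitVec_mem (h2 : (2 : K) ≠ 0) (h3 : (3 : K) ≠ 0)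
    (S : AddSubgroup (K × K)) (hS : ∀ t ≠ 0, unitVec t ∈ S) : S = ⊤ := by
  have left (c : K) : (c, (0 : K)) ∈ S := by
    rcases eq_or_ne c 0 with rfl | hc
    · exact zero_mem S
    have h : unitVec (2 * c / 3) + unitVec (2 * c / 3) - unitVec (c / 3) ∈ S :=
      sub_mem (add_mem (hS _ (div_ne_zero (mul_ne_zero h2 hc) h3))
        (hS _ (div_ne_zero (mul_ne_zero h2 hc) h3))) (hS _ (div_ne_zero hc h3))
    convert h using 1
    ext
    · simp; field_simp; norm_num
    · simp; field_simp; norm_num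
  have right (c : K) : ((0 : K), c) ∈ S := by
    rcases eq_or_ne c 0 with rfl | hc
    · exact zero_mem S
    have h : unitVec (3 / (2 * c)) + unitVec (3 / (2 * c)) - unitVec (3 / c) ∈ S :=
      sub_mem (add_mem (hS _ (div_ne_zero h3 (mul_ne_zero h2 hc)))
        (hS _ (div_ne_zero h3 (mul_ne_zero h2 hc)))) (hS _ (div_ne_zero h3 hc))
    convert h using 1
    ext
    · simp; field_simp; norm_num
    · simp; field_simp; norm_num
  refine eq_top_iff.2 fun v _ => ?_
  simpa using add_mem (left v.1) (right v.2)

/-- A map whose differences along unit vectors are constant is additive up to a translation. -/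
lemma exists_addMonoidHom_of_mem_stepPeriods (h2 : (2 : K) ≠ 0) (h3 : (3 : K) ≠ 0)
    {F : K × K → K × K}
    (h : ∀ s ≠ 0, ∀ t ≠ 0, unitVec s ∈ stepPeriods F (unitVec t)) :
    ∃ G : K × K →+ K × K, ∀ v, F v = G v + F 0 := by
  have key (t : K) (ht : t ≠ 0) (x : K × K) : F (x + unitVec t) - F x = F (unitVec t) - F 0 := by
    have hx : x ∈ stepPeriods F (unitVec t) := by
      rw [addSubgroup_eq_top_of_unitVec_mem h2 h3 (stepPeriods F (unitVec t))
        fun s hs => h s hs t ht]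
      trivial
    simpa using hx 0
  let S : AddSubgroup (K × K) :=
    { carrier := {v | ∀ x, F (x + v) - F x = F v - F 0}
      zero_mem' := by intro x; simp
      add_mem' := by
        intro v w hv hw x
        have h1 := hw (x + v)
        have h2 := hw v
        rw [← add_assoc]
        linear_combination (exp := 1) hv x + h1 - h2
      neg_mem' := by
        intro v hv x
        have h1 := hv (x + -v)
        have h2 := hv (-v)
        rw [neg_add_cancel_right] at h1
        rw [neg_add_cancel] at h2
        linear_combination (exp := 1) h2 - h1 }
  have hS : S = ⊤ := addSubgroup_eq_top_of_unitVec_mem h2 h3 S key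
  refine ⟨AddMonoidHom.mk' (fun v => F v - F 0) fun v w => ?_, fun v => by simp⟩
  have hw : w ∈ S := hS ▸ AddSubgroup.mem_top w
  linear_combination (exp := 1) hw v

/-! ### Additive maps preserving unit vectors -/

/-- A group is not the union of two proper subgroups; here these are two kernels. -/
lemma addMonoidHom_eq_zero_or_eq_zero {f g : K →+ K} (h : ∀ t, f t * g t = 0) :
    f = 0 ∨ g = 0 := by
  by_contra! hne
  obtain ⟨x, hx⟩ := DFunLike.ne_iff.1 hne.1
  obtain ⟨y, hy⟩ := DFunLike.ne_iff.1 hne.2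
  simp only [AddMonoidHom.zero_apply] at hx hy
  have hgx : g x = 0 := (mul_eq_zero.1 (h x)).resolve_left hx
  have hfy : f y = 0 := (mul_eq_zero.1 (h y)).resolve_right hy
  have := h (x + y)
  simp [hgx, hfy, hx, hy] at this

/-- Additive maps `α`, `δ` with `α t * δ t⁻¹ = 1` are inverse multiples of one field
homomorphism, by Hua's identity `t⁻¹ + (1 - t)⁻¹ = (t - t ^ 2)⁻¹`. -/
lemma exists_ringHom_of_mul_inv_eq_one (h2 : (2 : K) ≠ 0) {α δ : K →+ K}
    (h : ∀ t ≠ 0, α t * δ t⁻¹ = 1) :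
    ∃ (σ : K →+* K) (a : K), a ≠ 0 ∧ (∀ t, α t = a * σ t) ∧ ∀ t, δ t = a⁻¹ * σ t := by
  have hα {t : K} (ht : t ≠ 0) : α t ≠ 0 := left_ne_zero_of_mul_eq_one (h t ht)
  have hδ {t : K} (ht : t ≠ 0) : δ t⁻¹ = (α t)⁻¹ := (inv_eq_of_mul_eq_one_right (h t ht)).symm
  have ha : α 1 ≠ 0 := hα one_ne_zero
  have hsq (t : K) : α 1 * α (t * t) = α t * α t := by
    rcases eq_or_ne t 0 with rfl | ht
    · simp
    rcases eq_or_ne t 1 with rfl | ht1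
    · simp
    have ht1' : 1 - t ≠ 0 := sub_ne_zero.2 ht1.symm
    have e : t⁻¹ + (1 - t)⁻¹ = (t * (1 - t))⁻¹ := by field_simp; ring
    have e' := congrArg δ e
    rw [map_add, hδ ht, hδ ht1', hδ (mul_ne_zero ht ht1')] at e'
    have n1 := hα ht
    have n2 := hα ht1'
    have n3 := hα (mul_ne_zero ht ht1')
    field_simp at e'
    simp only [mul_sub, mul_one, map_sub] at e'
    linear_combination -e'
  let σ : K →+* K := (AddMonoidHom.mulLeft (α 1)⁻¹ |>.comp α).mkRingHomOfMulSelfOfTwoNeZero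
    (by
      intro t
      simp only [AddMonoidHom.comp_apply, AddMonoidHom.coe_mulLeft]
      linear_combination (α 1)⁻¹ ^ 2 * hsq t - (α 1)⁻¹ * α (t * t) * mul_inv_cancel₀ ha)
    h2 (by simp [ha])
  have hσ (t : K) : σ t = (α 1)⁻¹ * α t := rfl
  refine ⟨σ, α 1, ha, fun t => by rw [hσ, mul_inv_cancel_left₀ ha], fun t => ?_⟩
  rcases eq_or_ne t 0 with rfl | ht
  · simp
  have h1 := hδ (inv_ne_zero ht)
  have e : α t⁻¹ = α 1 * (σ t)⁻¹ := by rw [← map_inv₀, hσ, mul_inv_cancel_left₀ ha]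
  rw [inv_inv] at h1
  rw [h1, e, mul_inv, inv_inv]

/-- An additive map preserving the unit vectors is semilinear and maps each of the two null
directions to a null direction. -/
lemma exists_ringHom_of_map_unitVec (h2 : (2 : K) ≠ 0) (h3 : (3 : K) ≠ 0) (h5 : (5 : K) ≠ 0)
    (G : K × K →+ K × K) (hG : ∀ t ≠ 0, (G (unitVec t)).1 * (G (unitVec t)).2 = 1) :
    ∃ (σ : K →+* K) (a : K), a ≠ 0 ∧
      ((∀ u v, G (u, v) = (a * σ u, a⁻¹ * σ v)) ∨ ∀ u v, G (u, v) = (a * σ v, a⁻¹ * σ u)) := by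
  let α : K →+ K := (AddMonoidHom.fst K K).comp (G.comp (AddMonoidHom.inl K K))
  let β : K →+ K := (AddMonoidHom.fst K K).comp (G.comp (AddMonoidHom.inr K K))
  let γ : K →+ K := (AddMonoidHom.snd K K).comp (G.comp (AddMonoidHom.inl K K))
  let δ : K →+ K := (AddMonoidHom.snd K K).comp (G.comp (AddMonoidHom.inr K K))
  have hsplit (u v : K) : G (u, v) = (α u + β v, γ u + δ v) := by
    have e : ((u, v) : K × K) = (u, 0) + (0, v) := by simp
    rw [e, map_add]
    rfl
  have hE (t : K) (ht : t ≠ 0) : (α t + β t⁻¹) * (γ t + δ t⁻¹) = 1 := by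
    have := hG t ht
    rwa [unitVec, hsplit] at this
  -- Comparing the equations for `t`, `2 * t` and `3 * t` isolates the terms of each degree.
  have hXY (t : K) (ht : t ≠ 0) : α t * γ t = 0 ∧ β t⁻¹ * δ t⁻¹ = 0 := by
    have scale (n : ℕ) (hn : (n : K) ≠ 0) :
        (n ^ 2 * α t + β t⁻¹) * (n ^ 2 * γ t + δ t⁻¹) = n ^ 2 := by
      have e := hE (n * t) (mul_ne_zero hn ht)
      have hl (f : K →+ K) : f (n * t) = n * f t := by
        rw [← nsmul_eq_mul, map_nsmul, nsmul_eq_mul]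
      have hr (f : K →+ K) : n * f (n * t)⁻¹ = f t⁻¹ := by
        rw [← nsmul_eq_mul, ← map_nsmul, nsmul_eq_mul, mul_inv, mul_inv_cancel_left₀ hn]
      rw [hl, hl] at e
      rw [← hr β, ← hr δ]
      linear_combination (n : K) ^ 2 * e
    have e1 := hE t ht
    have e2 := scale 2 (by exact_mod_cast h2)
    have e3 := scale 3 (by exact_mod_cast h3)
    push_cast at e2 e3
    have f2 : 4 * (α t * γ t) - β t⁻¹ * δ t⁻¹ = 0 := by
      refine mul_left_cancel₀ h3 ?_
      linear_combination e2 - 4 * e1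
    have f3 : 9 * (α t * γ t) - β t⁻¹ * δ t⁻¹ = 0 := by
      have h8 : (8 : K) ≠ 0 := by
        rw [show (8 : K) = 2 * 2 * 2 by norm_num]
        exact mul_ne_zero (mul_ne_zero h2 h2) h2
      refine mul_left_cancel₀ h8 ?_
      linear_combination e3 - 9 * e1
    have hX : α t * γ t = 0 := by
      refine mul_left_cancel₀ h5 ?_
      linear_combination f3 - f2
    exact ⟨hX, by linear_combination 4 * hX - f2⟩
  have h1 : α = 0 ∨ γ = 0 := by
    apply addMonoidHom_eq_zero_or_eq_zero
    intro t
    rcases eq_or_ne t 0 with rfl | ht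
    · simp
    · exact (hXY t ht).1
  have h1' : β = 0 ∨ δ = 0 := by
    apply addMonoidHom_eq_zero_or_eq_zero
    intro t
    rcases eq_or_ne t 0 with rfl | ht
    · simp
    · simpa using (hXY t⁻¹ (inv_ne_zero ht)).2
  rcases h1 with hα | hγ
  · rcases h1' with hβ | hδ
    · have := hE 1 one_ne_zero
      simp [hα, hβ] at this
    · obtain ⟨σ, a, ha, e1, e2⟩ := exists_ringHom_of_mul_inv_eq_one h2 (α := β) (δ := γ)
        fun t ht => by simpa [hα, hδ] using hE t⁻¹ (inv_ne_zero ht)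
      refine ⟨σ, a, ha, Or.inr fun u v => ?_⟩
      rw [hsplit, hα, hδ, e1, e2]
      simp
  · rcases h1' with hβ | hδ
    · obtain ⟨σ, a, ha, e1, e2⟩ := exists_ringHom_of_mul_inv_eq_one h2 (α := α) (δ := δ)
        fun t ht => by simpa [hγ, hβ] using hE t ht
      refine ⟨σ, a, ha, Or.inl fun u v => ?_⟩
      rw [hsplit, hγ, hβ, e1, e2]
      simp
    · have := hE 1 one_ne_zero
      simp [hγ, hδ] at this

/-- Unit-preserving maps of the hyperbolic plane are, up to translation, additive. -/
lemma PreservesUnitAdj.exists_addMonoidHom (h2 : (2 : K) ≠ 0) (h3 : (3 : K) ≠ 0)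
    (h5 : (5 : K) ≠ 0) {F : K × K → K × K} (hF : PreservesUnitAdj F) :
    ∃ G : K × K →+ K × K, (∀ v, F v = G v + F 0) ∧
      ∀ t ≠ 0, (G (unitVec t)).1 * (G (unitVec t)).2 = 1 := by
  have hs : ∀ t ≠ 0, unitVec t ∈ stepPeriods F (unitVec t) := by
    intro t ht
    by_cases hω : ∃ ω : K, ω ^ 2 - ω + 1 = 0
    · obtain ⟨ω, hω⟩ := hω
      exact unitVec_mem_stepPeriods_self_of_triangle h2 h3 h5 hF hω ht
    · push Not at hω
      exact unitVec_mem_stepPeriods_self_of_no_triangle h2 h3 h5 hF hω ht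
  obtain ⟨G, hG⟩ := exists_addMonoidHom_of_mem_stepPeriods h2 h3
    fun s hs0 t ht => unitVec_mem_stepPeriods_of_self h2 hF hs hs0 ht
  refine ⟨G, hG, fun t ht => ?_⟩
  have := (hF _ _ (unitAdj_add_unitVec 0 ht)).symm
  simpa [UnitAdj, hG (unitVec t)] using this

end HyperbolicPlane

/-! ### Null coordinates -/

lemma natCast_ne_zero_of_ringChar_ne {K : Type*} [Field K] {p : ℕ} (hp : p.Prime)
    (h : ringChar K ≠ p) : (p : K) ≠ 0 := by
  intro h0
  rcases (Nat.dvd_prime hp).1 ((ringChar.spec K p).1 h0) with h1 | h1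
  · exact CharP.ringChar_ne_one h1
  · exact h h1

theorem theorem4 {K : Type*} [Field K] (hchar : ringChar K ∉ ({2, 3, 5} : Set ℕ))
    (hi : ∃ i : K, i ^ 2 + 1 = 0)
    (f : (Fin 2 → K) → (Fin 2 → K)) (hf : PreservesUnitDistance f) :
    ∃ (σ : K →+* K) (I : (Fin 2 → K) →ᵃ[K] (Fin 2 → K)),
      HasOrthogonalLinearPart I ∧ f = I ∘ fun X => ![σ (X 0), σ (X 1)] := by
  simp only [Set.mem_insert_iff, Set.mem_singleton_iff, not_or] at hchar
  have h2 : (2 : K) ≠ 0 := by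
    exact_mod_cast natCast_ne_zero_of_ringChar_ne Nat.prime_two hchar.1
  have h3 : (3 : K) ≠ 0 := by
    exact_mod_cast natCast_ne_zero_of_ringChar_ne Nat.prime_three hchar.2.1
  have h5 : (5 : K) ≠ 0 := by
    exact_mod_cast natCast_ne_zero_of_ringChar_ne Nat.prime_five hchar.2.2
  obtain ⟨i, hi⟩ := hi
  have hi2 : i * i = -1 := by linear_combination hi
  have hi0 : i ≠ 0 := by
    rintro rfl
    simp at hi
  -- Passage to the coordinates `u = x + i y`, `v = x - i y`, in which the distance is `u * v`.
  let toNull : (Fin 2 → K) → K × K := fun X => (X 0 + i * X 1, X 0 - i * X 1)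
  let ofNull : K × K → (Fin 2 → K) := fun p => ![(p.1 + p.2) / 2, (p.1 - p.2) / (2 * i)]
  have h_of_to (X : Fin 2 → K) : ofNull (toNull X) = X := by
    funext k
    fin_cases k
    · simp [ofNull, toNull]; field_simp; ring
    · simp [ofNull, toNull]; field_simp; ring
  have hphi (X Y : Fin 2 → K) :
      ((toNull X).1 - (toNull Y).1) * ((toNull X).2 - (toNull Y).2) = phiK X Y := by
    simp only [toNull, phiK]
    linear_combination -(X 1 - Y 1) ^ 2 * hi
  have h_to_of (p : K × K) : toNull (ofNull p) = p := by
    ext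
    · simp [ofNull, toNull]; field_simp; ring
    · simp [ofNull, toNull]; field_simp; ring
  have hF : PreservesUnitAdj (toNull ∘ f ∘ ofNull) := by
    intro p q h
    simp only [UnitAdj, Function.comp_apply, hphi]
    apply hf
    rw [← hphi, h_to_of, h_to_of]
    exact h
  obtain ⟨G, hG, hG1⟩ := hF.exists_addMonoidHom h2 h3 h5
  obtain ⟨σ, a, ha, hσ⟩ := exists_ringHom_of_map_unitVec h2 h3 h5 G hG1
  have hσi : σ i = i ∨ σ i = -i := by
    apply mul_self_eq_mul_self_iff.1
    rw [← map_mul, hi2, map_neg, map_one]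
  -- In all cases `G` acts on the null coordinates through `j = ± i`.
  obtain ⟨j, hj, hGj⟩ : ∃ j : K, j * j = -1 ∧ ∀ X : Fin 2 → K, G (toNull X) =
      (a * (σ (X 0) + j * σ (X 1)), a⁻¹ * (σ (X 0) - j * σ (X 1))) := by
    have hσii : σ i * σ i = -1 := by rw [← map_mul, hi2, map_neg, map_one]
    rcases hσ with hσ | hσ
    · exact ⟨σ i, hσii, fun X => by simp [toNull, hσ]⟩
    · exact ⟨-σ i, by linear_combination hσii, fun X => by simp [toNull, hσ, sub_eq_add_neg]⟩
  let M : Matrix (Fin 2) (Fin 2) K :=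
    !![(a + a⁻¹) / 2, j * (a - a⁻¹) / 2; (a - a⁻¹) / (2 * i), j * (a + a⁻¹) / (2 * i)]
  refine ⟨σ, (Matrix.toLin' M).toAffineMap + AffineMap.const K _ (f 0), ?_, ?_⟩
  · have hlin : ((Matrix.toLin' M).toAffineMap + AffineMap.const K _ (f 0)).linear =
        Matrix.toLin' M := by simp
    rw [HasOrthogonalLinearPart, hlin, LinearMap.toMatrix'_toLin', Matrix.mem_orthogonalGroup_iff]
    ext k l
    fin_cases k <;> fin_cases l
    · simp [M, Matrix.mul_apply, Fin.sum_univ_two]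
      field_simp
      linear_combination (a ^ 2 - 1) ^ 2 * hj
    · simp [M, Matrix.mul_apply, Fin.sum_univ_two]
      field_simp
      linear_combination (a ^ 2 + 1) * (a ^ 2 - 1) * hj
    · simp [M, Matrix.mul_apply, Fin.sum_univ_two]
      field_simp
      linear_combination (a ^ 2 + 1) * (a ^ 2 - 1) * hj
    · simp [M, Matrix.mul_apply, Fin.sum_univ_two]
      field_simp
      linear_combination (a ^ 2 + 1) ^ 2 * hj - 4 * a ^ 2 * hi2
  · funext X
    have h0 : ofNull 0 = 0 := by
      funext k
      fin_cases k <;> simp [ofNull]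
    have hX := hG (toNull X)
    simp only [Function.comp_apply, h_of_to, h0, hGj] at hX
    rw [← h_of_to (f X), hX]
    funext k
    fin_cases k
    · simp [ofNull, toNull, M]
      field_simp
      ring
    · simp [ofNull, toNull, M]
      field_simp
      ring
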